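/- Let $d, k \ge 0$ be integers. A finite set $X \subset \mathbb{R}^d$ is in general position if every subset of $X$ with at most $d+1$ points is affinely independent. A finite set $X\subset\mathbb{R}^d$ is called $k$-divisible if there are sets $A, B$ with $A \cap B = \emptyset$ and $A \cup B = X$ such that $$\operatorname{conv}(A \setminus K) \cap \operatorname{conv}(B \setminus K) \neq \emptyset \quad \text{for every } K \subseteq X \text{ with } |K| = k.$$ Then every set $X$ of $(k+1)d + (k+2)$ points in general position in $\mathbb{R}^d$ is $k$-divisible. Moreover, let $\lambda(d,k)$ be the smallest integer $n \ge k$ such that every set of $n$ points in $\mathbb{R}^d$ (in general position or not) is $k$-divisible. Then $\lambda(d,k)$ exists and $$\lambda(d,k) \le (k+1)d + (k+2).$$ -/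

import Mathlib

/-- A finite set of points of `ℝ^d` is in general position if each of its subsets with at most
`d + 1` elements is affinely independent. -/
def InGeneralPosition {d : ℕ} (X : Finset (EuclideanSpace ℝ (Fin d))) : Prop :=
  ∀ Y : Finset (EuclideanSpace ℝ (Fin d)), Y ⊆ X → Y.card ≤ d + 1 →
    AffineIndependent ℝ (fun y : Y => (y : EuclideanSpace ℝ (Fin d)))

/-- `X` is `k`-divisible: there is one partition of `X` into two sets `A` and `B` whose convex hulls
still meet after the removal of an arbitrary `k`-element subset `K` of `X`. -/
def IsKDivisible {d : ℕ} (k : ℕ) (X : Finset (EuclideanSpace ℝ (Fin d))) : Prop :=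
  ∃ A B : Set (EuclideanSpace ℝ (Fin d)), A ∩ B = ∅ ∧ A ∪ B = (X : Set _) ∧
    ∀ K : Finset (EuclideanSpace ℝ (Fin d)), K ⊆ X → K.card = k →
      (convexHull ℝ (A \ (K : Set _)) ∩ convexHull ℝ (B \ (K : Set _))).Nonempty

/-- The numbers `n` such that every set of `n` points of `ℝ^d`, in general position or not, is
`k`-divisible. The clause `k ≤ n` only discards sets too small to have a `k`-element subset. -/
def divisibleSizes (d k : ℕ) : Set ℕ :=
  {n | k ≤ n ∧ ∀ X : Finset (EuclideanSpace ℝ (Fin d)), X.card = n → IsKDivisible k X}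

/-- The number `λ(d, k)`: the smallest `n ≥ k` such that every set of `n` points of `ℝ^d` is
`k`-divisible. -/
noncomputable def divisibilityNumber (d k : ℕ) : ℕ :=
  sInf (divisibleSizes d k)

/-! Lift each point `x` to `(x, 1)` in dimension `D = d + 1`. Signs on the lifts encode the
partition: a convex combination of signed lifts equal to 0 is a Radon point of the two classes. It
remains to sign `t * D + 1` vectors, `t = k + 1`, so that 0 survives any deletion of fewer than `t`
(`exists_signs_zero_mem_convexHull`). Take signs minimizing the worst distance from 0 to a surviving
hull. If it is positive, the nearest point `p` needs only a set `T` of at most `D` vectors;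
re-signing the others by induction on `t` lowers the worst distance. -/

section SignChoice

variable {E : Type*} [NormedAddCommGroup E] [InnerProductSpace ℝ E]

/-- If `y` lies strictly below the hyperplane through `p` orthogonal to `p`, then some point of the
segment from `p` to `y` is closer to the origin than `p`. -/
theorem exists_mem_segment_norm_lt {p y : E} (h : inner ℝ p y < ‖p‖ ^ 2) :
    ∃ q ∈ segment ℝ p y, ‖q‖ < ‖p‖ := by
  have hyp : y - p ≠ 0 := by
    intro h0
    rw [sub_eq_zero.1 h0, real_inner_self_eq_norm_sq] at h
    exact lt_irrefl _ h
  have hm : 0 < ‖y - p‖ ^ 2 := by positivity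
  have hc : 0 < ‖p‖ ^ 2 - inner ℝ p y := sub_pos.2 h
  set c := ‖p‖ ^ 2 - inner ℝ p y with hcdef
  set m := ‖y - p‖ ^ 2 with hmdef
  -- At parameter `a` the squared norm changes by `-2ac + a²m`, which is at most `-ac` once `a * m ≤
  -- c`.
  set a := min 1 (c / m) with hadef
  have ha0 : 0 < a := lt_min one_pos (div_pos hc hm)
  have ham : a * m ≤ c := by
    calc a * m ≤ c / m * m := by gcongr; exact min_le_right _ _
      _ = c := div_mul_cancel₀ _ hm.ne'
  refine ⟨p + a • (y - p), ?_, ?_⟩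
  · rw [segment_eq_image']
    exact ⟨a, ⟨ha0.le, min_le_left _ _⟩, rfl⟩
  · have hq : ‖p + a • (y - p)‖ ^ 2 = ‖p‖ ^ 2 - 2 * a * c + a ^ 2 * m := by
      rw [norm_add_sq_real, norm_smul, real_inner_smul_right, inner_sub_right,
        real_inner_self_eq_norm_sq, mul_pow, Real.norm_eq_abs, sq_abs]
      ring
    refine lt_of_pow_lt_pow_left₀ 2 (norm_nonneg _) ?_
    rw [hq]
    nlinarith [mul_pos ha0 hc, mul_le_mul_of_nonneg_left ham ha0.le]

/-- A nonzero point of minimal norm in the convex hull of `v '' s` lies in the convex hull of at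
most `finrank ℝ E` of the points `v i`. -/
theorem exists_card_le_finrank_mem_convexHull [FiniteDimensional ℝ E] {ι : Type*}
    [DecidableEq ι] {v : ι → E} {s : Set ι} {p : E} (hp : p ∈ convexHull ℝ (v '' s))
    (hp0 : p ≠ 0) (hmin : ∀ q ∈ convexHull ℝ (v '' s), ‖p‖ ≤ ‖q‖) :
    ∃ T : Finset ι, (T : Set ι) ⊆ s ∧ T.card ≤ Module.finrank ℝ E ∧
      p ∈ convexHull ℝ (v '' (T : Set ι)) := by
  have hle : ∀ y ∈ convexHull ℝ (v '' s), ‖p‖ ^ 2 ≤ inner ℝ p y := by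
    intro y hy
    by_contra! hlt
    obtain ⟨q, hq, hqp⟩ := exists_mem_segment_norm_lt hlt
    exact hqp.not_ge (hmin q ((convex_convexHull ℝ _).segment_subset hp hy hq))
  obtain ⟨κ, _, z, w, hz, hind, hw, hw1, hwz⟩ := eq_pos_convex_span_of_mem_convexHull hp
  have hzs : ∀ i, ∃ j ∈ s, v j = z i := fun i => hz ⟨i, rfl⟩
  choose j hjs hj using hzs
  -- Positive weights average to `p`, so every `z i` lies on the supporting hyperplane at `p`; this
  -- saves one point over Carathéodory's `D + 1`.
  have heq : ∀ i, inner ℝ p (z i) = ‖p‖ ^ 2 := by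
    have hsum : ∑ i, w i * (inner ℝ p (z i) - ‖p‖ ^ 2) = 0 := by
      simp_rw [mul_sub, Finset.sum_sub_distrib, ← Finset.sum_mul, hw1, ← real_inner_smul_right,
        ← inner_sum, hwz, real_inner_self_eq_norm_sq]
      ring
    have hnn : ∀ i ∈ Finset.univ, 0 ≤ w i * (inner ℝ p (z i) - ‖p‖ ^ 2) := fun i _ =>
      mul_nonneg (hw i).le (sub_nonneg.2 (hle _ (subset_convexHull ℝ _ (hz ⟨i, rfl⟩))))
    intro i
    have := (Finset.sum_eq_zero_iff_of_nonneg hnn).1 hsum i (Finset.mem_univ i)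
    rcases mul_eq_zero.1 this with h | h
    · exact absurd h (hw i).ne'
    · linarith
  have hspan : vectorSpan ℝ (Set.range z) ≤ (ℝ ∙ p)ᗮ := by
    rw [vectorSpan_def, Submodule.span_le]
    rintro _ ⟨_, ⟨a, rfl⟩, _, ⟨b, rfl⟩, rfl⟩
    simp only [SetLike.mem_coe, Submodule.mem_orthogonal_singleton_iff_inner_right,
      vsub_eq_sub, inner_sub_right, heq, sub_self]
  have hcard : Fintype.card κ ≤ Module.finrank ℝ E := by
    have h1 := hind.card_le_finrank_succ
    have h2 := Submodule.finrank_mono hspan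
    have h3 := Submodule.finrank_add_finrank_orthogonal (ℝ ∙ p)
    rw [finrank_span_singleton hp0] at h3
    omega
  refine ⟨Finset.univ.image j, ?_, Finset.card_image_le.trans hcard, ?_⟩
  · rintro _ hi
    obtain ⟨i, -, rfl⟩ := Finset.mem_image.1 (Finset.mem_coe.1 hi)
    exact hjs i
  · rw [← hwz]
    refine (convex_convexHull ℝ _).sum_mem (fun i _ => (hw i).le) hw1 fun i _ => ?_
    exact subset_convexHull ℝ _ ⟨j i, by simp, hj i⟩

/-- Among the vectors `ε i • v i`, `i ∈ R`, or among their negatives, more than half lie in a given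
closed half-space bounded by a linear hyperplane. -/
theorem exists_sign_card_inner_nonpos {ι : Type*} [DecidableEq ι] {R : Finset ι} {t : ℕ}
    (hR : 2 * t < R.card) (u : ι → E) (p : E) :
    ∃ σ : ℤˣ, t < (R.filter fun i => inner ℝ p (σ • u i) ≤ 0).card := by
  by_contra! h
  have h1 := h 1
  have h2 := h (-1)
  have hsub : R ⊆ (R.filter fun i => inner ℝ p ((1 : ℤˣ) • u i) ≤ 0) ∪
      (R.filter fun i => inner ℝ p ((-1 : ℤˣ) • u i) ≤ 0) := by
    intro i hi
    simp only [Finset.mem_union, Finset.mem_filter, hi, true_and, one_smul, Units.neg_smul,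
      inner_neg_right, neg_nonpos]
    exact le_total _ _
  have h3 := (Finset.card_le_card hsub).trans (Finset.card_union_le _ _)
  omega

/-- If the convex hull of a family of vectors contains the origin, then so does the convex hull of
the family with all signs changed. -/
theorem zero_mem_convexHull_units_smul {ι : Type*} {u : ι → E} {s : Set ι} (σ : ℤˣ)
    (h : (0 : E) ∈ convexHull ℝ (u '' s)) :
    (0 : E) ∈ convexHull ℝ ((fun i => σ • u i) '' s) := by
  rcases Int.units_eq_one_or σ with rfl | rfl
  · simpa using h
  · have : (fun i => (-1 : ℤˣ) • u i) '' s = -(u '' s) := by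
      rw [← Set.image_neg_eq_neg, Set.image_image]
      simp
    rw [this, convexHull_neg]
    simpa using h

/-- A family of at least `t * D + 1` vectors in a space of dimension `D ≥ 2` can be signed so that
the origin stays in the convex hull after the removal of fewer than `t` vectors. -/
theorem exists_signs_zero_mem_convexHull [FiniteDimensional ℝ E] {ι : Type*} [Fintype ι]
    [DecidableEq ι] (hD : 2 ≤ Module.finrank ℝ E) (v : ι → E) (t : ℕ) :
    ∀ s : Finset ι, t * Module.finrank ℝ E + 1 ≤ s.card →
      ∃ ε : ι → ℤˣ, ∀ K : Finset ι, K.card < t →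
        (0 : E) ∈ convexHull ℝ ((fun i => ε i • v i) '' ((s \ K : Finset ι) : Set ι)) := by
  induction t with
  | zero => exact fun s _ => ⟨1, fun K hK => absurd hK (Nat.not_lt_zero _)⟩
  | succ t ih =>
    intro s hs
    set D := Module.finrank ℝ E with hDdef
    let C : (ι → ℤˣ) → Finset ι → Set E := fun ε K =>
      convexHull ℝ ((fun i => ε i • v i) '' ((s \ K : Finset ι) : Set ι))
    have hst : t + 1 < s.card := by nlinarith
    have hCne : ∀ ε K, K.card < t + 1 → (C ε K).Nonempty := by
      intro ε K hK
      obtain ⟨i, hi⟩ : (s \ K).Nonempty := by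
        rw [← Finset.card_pos]
        have := Finset.le_card_sdiff K s
        omega
      exact ⟨_, subset_convexHull ℝ _ ⟨i, hi, rfl⟩⟩
    have hCcpt : ∀ ε K, IsCompact (C ε K) := fun ε K =>
      ((Finset.finite_toSet _).image _).isCompact_convexHull (𝕜 := ℝ)
    let 𝒦 : Finset (Finset ι) := Finset.univ.filter fun K => K.card < t + 1
    have h𝒦 : 𝒦.Nonempty := ⟨∅, by simp [𝒦]⟩
    let f : (ι → ℤˣ) → ℝ := fun ε => 𝒦.sup' h𝒦 fun K => Metric.infDist 0 (C ε K)
    obtain ⟨ε, hε⟩ := Finite.exists_min f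
    obtain ⟨K, hK, hKf⟩ := Finset.exists_mem_eq_sup' h𝒦 fun K => Metric.infDist 0 (C ε K)
    have hKt : K.card < t + 1 := (Finset.mem_filter.1 hK).2
    obtain ⟨p, hpC, hp⟩ := (hCcpt ε K).exists_infDist_eq_dist (hCne ε K hKt) 0
    rw [dist_zero_left] at hp
    have hfp : f ε = ‖p‖ := hKf.trans hp
    refine ⟨ε, fun L hL => ?_⟩
    by_cases hp0 : p = 0
    · have h1 : Metric.infDist 0 (C ε L) ≤ f ε :=
        Finset.le_sup' (fun K => Metric.infDist 0 (C ε K)) (by simpa [𝒦] using hL)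
      rw [hfp, hp0, norm_zero] at h1
      exact ((hCcpt ε L).isClosed.mem_iff_infDist_zero (hCne ε L hL)).2
        (h1.antisymm Metric.infDist_nonneg)
    exfalso
    have hpmin : ∀ q ∈ C ε K, ‖p‖ ≤ ‖q‖ := fun q hq => by
      rw [← hp, ← dist_zero_left]
      exact Metric.infDist_le_dist_of_mem hq
    obtain ⟨T, hTs, hTD, hpT⟩ := exists_card_le_finrank_mem_convexHull hpC hp0 hpmin
    have hTs' : T ⊆ s := fun i hi => (Finset.mem_sdiff.1 (hTs hi)).1
    have hRcard : t * D + 1 ≤ (s \ T).card := by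
      have := Finset.le_card_sdiff T s
      rw [add_mul, one_mul] at hs
      omega
    obtain ⟨δ, hδ⟩ := ih (s \ T) hRcard
    -- `D ≥ 2` gives `2 * t < t * D + 1`. A common sign `σ` preserves the property of `δ`.
    obtain ⟨σ, hσ⟩ := exists_sign_card_inner_nonpos (R := s \ T) (t := t) (by nlinarith)
      (fun i => δ i • v i) p
    let η : ι → ℤˣ := fun i => if i ∈ T then ε i else σ * δ i
    have hηR : ∀ i ∉ T, η i • v i = σ • δ i • v i := fun i hi => by
      simp [η, hi, mul_smul]
    refine (hε η).not_gt ?_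
    rw [hfp, Finset.sup'_lt_iff]
    intro L hL
    have hLt : L.card < t + 1 := (Finset.mem_filter.1 hL).2
    -- If `L` misses `T`, then `p` survives, and so does a vector in the half-space pulling it
    -- closer to 0. Otherwise fewer than `t` deletions fall outside `T`, and induction applies.
    by_cases hTL : Disjoint T L
    · have hpη : p ∈ C η L := by
        refine convexHull_mono ?_ hpT
        rintro _ ⟨i, hi, rfl⟩
        refine ⟨i, Finset.mem_sdiff.2 ⟨hTs' hi, Finset.disjoint_left.1 hTL hi⟩, ?_⟩
        simp [η, Finset.mem_coe.1 hi]
      obtain ⟨i, hi, hiL⟩ := Finset.exists_mem_notMem_of_card_lt_card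
        ((Nat.lt_succ_iff.1 hLt).trans_lt hσ)
      obtain ⟨hiR, hip⟩ := Finset.mem_filter.1 hi
      obtain ⟨his, hiT⟩ := Finset.mem_sdiff.1 hiR
      rw [← hηR i hiT] at hip
      have hiη : η i • v i ∈ C η L :=
        subset_convexHull ℝ _ ⟨i, Finset.mem_sdiff.2 ⟨his, hiL⟩, rfl⟩
      obtain ⟨q, hq, hqp⟩ := exists_mem_segment_norm_lt
        (hip.trans_lt (by positivity : (0 : ℝ) < ‖p‖ ^ 2))
      refine lt_of_le_of_lt ?_ hqp
      rw [← dist_zero_left]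
      exact Metric.infDist_le_dist_of_mem
        ((convex_convexHull ℝ _).segment_subset hpη hiη hq)
    · have hLR : (L \ T).card < t := by
        have h1 : 0 < (T ∩ L).card := by
          rwa [Finset.card_pos, ← Finset.not_disjoint_iff_nonempty_inter]
        have h2 := Finset.card_sdiff_add_card_inter L T
        rw [Finset.inter_comm] at h2
        omega
      have h0 : (0 : E) ∈ C η L := by
        refine convexHull_mono ?_ (zero_mem_convexHull_units_smul σ (hδ _ hLR))
        rintro _ ⟨i, hi, rfl⟩
        simp only [Finset.coe_sdiff, Set.mem_sdiff, Finset.mem_coe, not_and, not_not] at hi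
        refine ⟨i, Finset.mem_sdiff.2 ⟨hi.1.1, fun h => hi.1.2 (hi.2 h)⟩, hηR i hi.1.2⟩
      rw [Metric.infDist_zero_of_mem h0]
      exact norm_pos_iff.2 hp0

end SignChoice

/-- A signed weighted sum is the sum over the positive signs minus the sum over the others. -/
theorem sum_smul_units_smul {F : Type*} [AddCommGroup F] [Module ℝ F] {ι : Type*} (s : Finset ι)
    (ε : ι → ℤˣ) (w : ι → ℝ) (g : ι → F) :
    ∑ i ∈ s, w i • ε i • g i =
      ∑ i ∈ s with ε i = 1, w i • g i - ∑ i ∈ s with ε i ≠ 1, w i • g i := by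
  rw [← Finset.sum_filter_add_sum_filter_not s (fun i => ε i = 1), sub_eq_add_neg,
    ← Finset.sum_neg_distrib]
  congr 1 <;> refine Finset.sum_congr rfl fun i hi => ?_
  · rw [(Finset.mem_filter.1 hi).2, one_smul]
  · rw [(Int.units_eq_one_or (ε i)).resolve_left (Finset.mem_filter.1 hi).2]
    simp [Units.neg_smul]

/-- If the origin lies in the convex hull of the signed lifts `± (x, 1)`, then the convex hulls of
the positively and of the negatively signed points meet. -/
theorem convexHull_inter_nonempty_of_signed_lift {E : Type*} [AddCommGroup E] [Module ℝ E]
    {ι : Type*} (s : Finset ι) (x : ι → E) (ε : ι → ℤˣ) (w : ι → ℝ)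
    (hw : ∀ i ∈ s, 0 ≤ w i) (hw1 : ∑ i ∈ s, w i = 1)
    (hε : ∑ i ∈ s, w i • ε i • (1 : ℝ) = 0) (hx : ∑ i ∈ s, w i • ε i • x i = 0) :
    (convexHull ℝ (x '' {i | i ∈ s ∧ ε i = 1}) ∩
      convexHull ℝ (x '' {i | i ∈ s ∧ ε i ≠ 1})).Nonempty := by
  classical
  rw [sum_smul_units_smul, sub_eq_zero] at hε hx
  simp only [smul_eq_mul, mul_one] at hε
  rw [← Finset.sum_filter_add_sum_filter_not s (fun i => ε i = 1)] at hw1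
  -- The last coordinate makes both classes weigh 1/2.
  have hpos : 0 < ∑ i ∈ s with ε i = 1, w i := by linarith
  have hpos' : 0 < ∑ i ∈ s with ε i ≠ 1, w i := by linarith
  refine ⟨(s.filter fun i => ε i = 1).centerMass w x, ?_, ?_⟩
  · exact Finset.centerMass_mem_convexHull _ (fun i hi => hw i (Finset.mem_filter.1 hi).1) hpos
      fun i hi => ⟨i, Finset.mem_filter.1 hi, rfl⟩
  · have : (s.filter fun i => ε i = 1).centerMass w x =
        (s.filter fun i => ε i ≠ 1).centerMass w x := by
      rw [Finset.centerMass, Finset.centerMass, hε, hx]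
    rw [this]
    exact Finset.centerMass_mem_convexHull _ (fun i hi => hw i (Finset.mem_filter.1 hi).1) hpos'
      fun i hi => ⟨i, Finset.mem_filter.1 hi, rfl⟩

/-- Every set of `(k + 1) * d + (k + 2)` points of `ℝ^d` is `k`-divisible. -/
theorem isKDivisible_of_card_eq {d k : ℕ} (X : Finset (EuclideanSpace ℝ (Fin d)))
    (hX : X.card = (k + 1) * d + (k + 2)) : IsKDivisible k X := by
  classical
  -- For `d = 0` no set has `k + 2` points; otherwise `d + 1 ≥ 2`.
  rcases Nat.eq_zero_or_pos d with rfl | hd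
  · have := Finset.card_le_one_of_subsingleton X
    omega
  let F := WithLp 2 (EuclideanSpace ℝ (Fin d) × ℝ)
  have hF : Module.finrank ℝ F = d + 1 := by
    rw [(WithLp.linearEquiv 2 ℝ (EuclideanSpace ℝ (Fin d) × ℝ)).finrank_eq]
    simp
  let v : X → F := fun x => WithLp.toLp 2 ((x : EuclideanSpace ℝ (Fin d)), (1 : ℝ))
  obtain ⟨ε, hε⟩ := exists_signs_zero_mem_convexHull (by omega) v (k + 1) Finset.univ (by
    rw [hF, Finset.card_univ, Fintype.card_coe, hX]
    ring_nf
    exact le_rfl)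
  refine ⟨(↑) '' {x : X | ε x = 1}, (↑) '' {x : X | ε x ≠ 1}, ?_, ?_, ?_⟩
  · rw [← Set.image_inter Subtype.val_injective]
    ext
    simp
  · rw [← Set.image_union]
    ext
    simp [em]
  · intro K _ hK
    let L : Finset X := K.preimage (↑) Subtype.val_injective.injOn
    have hL : L.card < k + 1 := by
      have : L.card ≤ K.card :=
        Finset.card_le_card_of_injOn (↑) (fun x hx => Finset.mem_preimage.1 hx)
          Subtype.val_injective.injOn
      omega
    have h0 := hε L hL
    obtain ⟨κ, _, w, z, hw, hw1, hz, hwz⟩ := mem_convexHull_iff_exists_fintype.1 h0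
    choose j hjL hj using hz
    have hj' : ∀ i, ε (j i) • v (j i) = z i := hj
    simp_rw [← hj'] at hwz
    have hfst := congrArg (WithLp.fstₗ 2 ℝ (EuclideanSpace ℝ (Fin d)) ℝ) hwz
    have hsnd := congrArg (WithLp.sndₗ 2 ℝ (EuclideanSpace ℝ (Fin d)) ℝ) hwz
    have hjK : ∀ i, (j i : EuclideanSpace ℝ (Fin d)) ∉ K := fun i hi =>
      (Finset.mem_sdiff.1 (hjL i)).2 (Finset.mem_preimage.2 hi)
    refine (convexHull_inter_nonempty_of_signed_lift Finset.univ
      (fun i => (j i : EuclideanSpace ℝ (Fin d))) (fun i => ε (j i)) w (fun i _ => hw i) hw1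
      ?_ ?_).mono (Set.inter_subset_inter (convexHull_mono ?_) (convexHull_mono ?_))
    · simpa [map_sum, Units.smul_def, v] using hsnd
    · simpa [map_sum, Units.smul_def, v] using hfst
    · rintro _ ⟨i, hi, rfl⟩
      exact ⟨⟨j i, hi.2, rfl⟩, hjK i⟩
    · rintro _ ⟨i, hi, rfl⟩
      exact ⟨⟨j i, hi.2, rfl⟩, hjK i⟩

theorem mainTheorem6 (d k : ℕ) :
    (∀ X : Finset (EuclideanSpace ℝ (Fin d)), X.card = (k + 1) * d + (k + 2) →
      InGeneralPosition X → IsKDivisible k X) ∧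
    IsLeast (divisibleSizes d k) (divisibilityNumber d k) ∧
    divisibilityNumber d k ≤ (k + 1) * d + (k + 2) := by
  have hmem : (k + 1) * d + (k + 2) ∈ divisibleSizes d k :=
    ⟨by omega, fun X hX => isKDivisible_of_card_eq X hX⟩
  exact ⟨fun X hX _ => isKDivisible_of_card_eq X hX,
    ⟨Nat.sInf_mem ⟨_, hmem⟩, fun _ hn => Nat.sInf_le hn⟩, Nat.sInf_le hmem⟩
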